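/- Let $L>0$ and let $a\in L^\infty(0,L)$ be such that, for some constants $0<\alpha<\beta$, $\alpha\le a(x)\le\beta$ for a.e. $x\in(0,L)$. Let $h\in L^2(0,L)$. Let $\phi:\mathbb{R}\to\mathbb{R}\cup\{+\infty\}$ be continuous as a function with values in $\mathbb{R}\cup\{+\infty\}$, with $\phi(s)<+\infty$ for every $s\neq 0$ (the value $\phi(0)=+\infty$ is allowed but not required). Assume that $\phi$ is integrable on each side of $0$, i.e. $\int_0^{\delta}\phi(t)\,dt<+\infty$ and $\int_{-\delta}^0\phi(t)\,dt<+\infty$ for every $0<\delta<1$, and that $\phi$ is bounded on $\mathbb{R}\setminus(-\delta,\delta)$ for every $\delta>0$. Then there exists at least one function $v$ such that $$ v\in H^1(0,L),\qquad \phi(v)\in L^2(0,L),\qquad a\,\frac{dv}{dx}=\phi(v)+h\ \text{ in }\mathcal{D}'(0,L),\qquad v(0)=0 . $$ Here $H^1(0,L)$ is the space of functions in $L^2(0,L)$ whose distributional derivative is in $L^2(0,L)$, each identified with its continuous representative on $[0,L]$, and $\phi(v)\in L^2(0,L)$ includes that $\phi(v)$ is finite a.e. in $(0,L)$. -/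

import Mathlib

open MeasureTheory Set TopologicalSpace
open scoped ENNReal Distributions

namespace SingularODE

/-- The open interval `(0, L)`, as an open subset of `ℝ`. -/
def interval (L : ℝ) : Opens ℝ := ⟨Ioo 0 L, isOpen_Ioo⟩

/-- Lebesgue measure on `(0, L)`. -/
noncomputable abbrev leb (L : ℝ) : Measure ℝ := volume.restrict (Ioo 0 L)

/-- `v ∈ H¹(0, L)` with distributional derivative `w`: both functions are in `L²(0, L)` and
`∫ v η' = - ∫ w η` for every smooth `η` with compact support in `(0, L)`. -/
structure HasH1Deriv (L : ℝ) (v w : ℝ → ℝ) : Prop where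
  memLp : MemLp v 2 (leb L)
  memLp_deriv : MemLp w 2 (leb L)
  integral_eq : ∀ η : 𝓓(interval L, ℝ),
    ∫ x, v x * deriv η x ∂(leb L) = - ∫ x, w x * η x ∂(leb L)

/-- An extended-real-valued function belongs to `L²(0, L)`: it is finite almost everywhere and
its real value is square integrable. -/
def EMemL2 (L : ℝ) (f : ℝ → EReal) : Prop :=
  (∀ᵐ x ∂(leb L), f x ≠ ⊤ ∧ f x ≠ ⊥) ∧ MemLp (fun x => (f x).toReal) 2 (leb L)

/-- `v` is a solution of `a v' = φ(v) + h` in `𝓓'(0, L)`, `v(0) = 0`, with `v ∈ H¹(0, L)` and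
`φ(v) ∈ L²(0, L)`. As usual, `v ∈ H¹(0, L)` is identified with its representative that is
continuous on `[0, L]`, which gives its meaning to `v(0) = 0`. -/
structure IsSolution (L : ℝ) (a h : ℝ → ℝ) (φ : ℝ → EReal) (v : ℝ → ℝ) : Prop where
  continuousOn : ContinuousOn v (Icc 0 L)
  phi_memL2 : EMemL2 L (fun x => φ (v x))
  equation : ∃ w : ℝ → ℝ, HasH1Deriv L v w ∧
    ∀ η : 𝓓(interval L, ℝ),
      ∫ x, a x * w x * η x ∂(leb L) = ∫ x, ((φ (v x)).toReal + h x) * η x ∂(leb L)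
  initial : v 0 = 0

/-- The hypotheses on `φ : ℝ → ℝ ∪ {+∞}`: continuous, finite off `0`, integrable on each side
of `0`, and bounded off each neighbourhood of `0`. -/
structure Admissible (φ : ℝ → EReal) : Prop where
  ne_bot : ∀ s, φ s ≠ ⊥
  continuous : Continuous φ
  ne_top : ∀ s, s ≠ 0 → φ s ≠ ⊤
  integrable_right : ∀ δ : ℝ, 0 < δ → δ < 1 →
    IntegrableOn (fun t => (φ t).toReal) (Ioo 0 δ) volume
  integrable_left : ∀ δ : ℝ, 0 < δ → δ < 1 →
    IntegrableOn (fun t => (φ t).toReal) (Ioo (-δ) 0) volume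
  bounded : ∀ δ : ℝ, 0 < δ → ∃ M : ℝ, ∀ s : ℝ, δ ≤ |s| → |(φ s).toReal| ≤ M

end SingularODE

namespace SingularODE

open Filter Topology intervalIntegral
open scoped NNReal

/-! Replace `φ` by its Lipschitz regularizations `φ_n(s) = inf_t (φ(t) + n|s - t|)`, which lie
between a constant `-C` and `φ`. The problem `a v' = φ_n(v) + h`, `v(0) = 0` is solved by Picard
iteration (`exists_caratheodory_solution`).

The decisive estimate tests the equation against `φ_n(v)`: since `φ_n(v) v'` integrates to
`∫₀^{v(L)} φ_n`, integrability of `φ` across `0` and a sup bound on `v` control `φ_n(v)` in `L²`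
uniformly in `n` (`exists_bounds_of_regularized`). Hence the solutions are uniformly 1/2-Hölder, and
a subsequence converges to some `u` by Arzelà–Ascoli.

Along it `φ_n(v_n) → φ(u)` pointwise in the extended reals (`tendsto_lipApprox`). By Fatou the limit
is finite a.e. and in `L²`; by Vitali the convergence holds in `L¹`, which suffices for the integral
equation. -/

/-! ### Carathéodory equations with Lipschitz nonlinearity. -/

/-- The Picard operator `u ↦ ∫₀ˣ (g(u) b + k)` on continuous functions on `[0, L]`. -/
noncomputable def picard {L : ℝ} (hL : 0 ≤ L) (g b k : ℝ → ℝ)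
    (hc : ∀ u : C(Icc 0 L, ℝ), Continuous fun x : ℝ =>
      ∫ t in (0 : ℝ)..x, (g (IccExtend hL u t) * b t + k t))
    (u : C(Icc 0 L, ℝ)) : C(Icc 0 L, ℝ) :=
  ⟨fun x => ∫ t in (0 : ℝ)..x, (g (IccExtend hL u t) * b t + k t),
    (hc u).comp continuous_subtype_val⟩

theorem intervalIntegrable_mul_bdd_add {g b k v : ℝ → ℝ} {B : ℝ} (hg : Continuous g)
    (hv : Continuous v) (hbm : AEStronglyMeasurable b volume) (hb : ∀ t, |b t| ≤ B)
    (hk : ∀ x y, IntervalIntegrable k volume x y) (x y : ℝ) :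
    IntervalIntegrable (fun t => g (v t) * b t + k t) volume x y := by
  refine IntervalIntegrable.add ?_ (hk x y)
  have h1 := (hg.comp hv).intervalIntegrable (μ := volume) x y
  rw [intervalIntegrable_iff] at h1 ⊢
  exact Integrable.mul_bdd (c := B) h1 hbm.restrict (ae_of_all _ hb)

/-- The factor `(M L)^n / n!` for the `n`-th Picard iterate tends to `0`, so some iterate is a
contraction however large `L` is. -/
theorem exists_caratheodory_solution {L B : ℝ} {K : ℝ≥0} (hL : 0 ≤ L) {g b k : ℝ → ℝ}
    (hg : LipschitzWith K g) (hbm : AEStronglyMeasurable b volume) (hb : ∀ t, |b t| ≤ B)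
    (hk : ∀ x y, IntervalIntegrable k volume x y) :
    ∃ v : ℝ → ℝ, Continuous v ∧
      ∀ x ∈ Icc 0 L, v x = ∫ t in (0 : ℝ)..x, (g (v t) * b t + k t) := by
  have hB : 0 ≤ B := (abs_nonneg _).trans (hb 0)
  have hext : ∀ u : C(Icc 0 L, ℝ), Continuous (IccExtend hL u) := fun u =>
    u.continuous.Icc_extend'
  have hint : ∀ (u : C(Icc 0 L, ℝ)) x y, IntervalIntegrable
      (fun t => g (IccExtend hL u t) * b t + k t) volume x y := fun u x y =>
    intervalIntegrable_mul_bdd_add hg.continuous (hext u) hbm hb hk x y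
  have hc : ∀ u : C(Icc 0 L, ℝ), Continuous fun x : ℝ =>
      ∫ t in (0 : ℝ)..x, (g (IccExtend hL u t) * b t + k t) := fun u =>
    continuous_primitive (hint u) 0
  set F := picard hL g b k hc
  set M : ℝ := K * B
  have hM : 0 ≤ M := mul_nonneg K.2 hB
  have key : ∀ (n : ℕ) (u u' : C(Icc 0 L, ℝ)) (x : Icc 0 L),
      |F^[n] u x - F^[n] u' x| ≤ (M * x) ^ n / n.factorial * dist u u' := by
    intro n u u'
    induction n with
    | zero =>
      intro x
      simpa [Real.dist_eq] using ContinuousMap.dist_apply_le_dist (f := u) (g := u') x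
    | succ n ih =>
      intro x
      rw [Function.iterate_succ_apply', Function.iterate_succ_apply']
      set p := F^[n] u
      set q := F^[n] u'
      change |(∫ t in (0 : ℝ)..x, (g (IccExtend hL p t) * b t + k t)) -
        ∫ t in (0 : ℝ)..x, (g (IccExtend hL q t) * b t + k t)| ≤ _
      rw [← integral_sub (hint p _ _) (hint q _ _), ← Real.norm_eq_abs]
      have hx0 : (0 : ℝ) ≤ x := x.2.1
      have h1 : ‖∫ t in (0 : ℝ)..x, ((g (IccExtend hL p t) * b t + k t) -
          (g (IccExtend hL q t) * b t + k t))‖ ≤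
          ∫ t in (0 : ℝ)..x, (M ^ (n + 1) / n.factorial * dist u u') * t ^ n := by
        refine norm_integral_le_of_norm_le hx0 (ae_of_all _ fun t ht => ?_)
          ((by fun_prop : Continuous fun t : ℝ => _).intervalIntegrable _ _)
        have htI : t ∈ Icc 0 L := ⟨ht.1.le, ht.2.trans x.2.2⟩
        rw [IccExtend_of_mem hL _ htI, IccExtend_of_mem hL _ htI]
        have h2 := ih ⟨t, htI⟩
        have h3 := hg.dist_le_mul (p ⟨t, htI⟩) (q ⟨t, htI⟩)
        rw [Real.dist_eq, Real.dist_eq] at h3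
        calc ‖g (p ⟨t, htI⟩) * b t + k t - (g (q ⟨t, htI⟩) * b t + k t)‖
            = |g (p ⟨t, htI⟩) - g (q ⟨t, htI⟩)| * |b t| := by
              rw [Real.norm_eq_abs, ← abs_mul]; congr 1; ring
          _ ≤ (K * ((M * t) ^ n / n.factorial * dist u u')) * B := by
              have h4 := h3.trans (mul_le_mul_of_nonneg_left h2 K.2)
              exact mul_le_mul h4 (hb t) (abs_nonneg _) ((abs_nonneg _).trans h4)
          _ = _ := by simp only [M]; ring
      refine h1.trans (le_of_eq ?_)
      rw [intervalIntegral.integral_const_mul, integral_pow, Nat.factorial_succ]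
      have : (n.factorial : ℝ) ≠ 0 := by positivity
      push_cast
      field_simp
      simp only [ne_eq, Nat.add_eq_zero_iff, one_ne_zero, and_false, not_false_eq_true,
        zero_pow, sub_zero]
      ring
  have hdist : ∀ (n : ℕ) (u u' : C(Icc 0 L, ℝ)),
      dist (F^[n] u) (F^[n] u') ≤ (M * L) ^ n / n.factorial * dist u u' := by
    intro n u u'
    refine (ContinuousMap.dist_le (by positivity)).2 fun x => ?_
    refine (key n u u' x).trans ?_
    have := x.2.1
    have := x.2.2
    gcongr
  obtain ⟨n, hn⟩ := ((FloorSemiring.tendsto_pow_div_factorial_atTop (M * L)).eventually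
    (gt_mem_nhds (zero_lt_one' ℝ))).exists
  have hcontr : ContractingWith (⟨(M * L) ^ n / n.factorial, by positivity⟩ : ℝ≥0) F^[n] :=
    ⟨by exact_mod_cast hn, LipschitzWith.of_dist_le_mul fun u u' => hdist n u u'⟩
  -- By uniqueness, the fixed point of the iterate is fixed by `F` itself.
  have hfix := hcontr.isFixedPt_fixedPoint_iterate
  set u := hcontr.fixedPoint F^[n]
  refine ⟨IccExtend hL u, hext u, fun x hx => ?_⟩
  rw [IccExtend_of_mem hL _ hx]
  conv_lhs => rw [← hfix.eq]
  rfl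

/-! ### Lipschitz regularization of `φ`. -/

/-- The Lipschitz regularization (infimal convolution with `n |·|`) of `φ`. -/
noncomputable def lipApprox (φ : ℝ → EReal) (n : ℕ) (s : ℝ) : ℝ :=
  ⨅ t : {t : ℝ // φ t ≠ ⊤}, ((φ t).toReal + n * |s - t|)

theorem Admissible.exists_lower_bound {φ : ℝ → EReal} (hφ : Admissible φ) :
    ∃ C : ℝ, 0 ≤ C ∧ ∀ s, ((-C : ℝ) : EReal) ≤ φ s := by
  obtain ⟨M, hM⟩ := hφ.bounded 1 one_pos
  obtain ⟨s₀, -, hs₀⟩ := (isCompact_Icc (a := (-1 : ℝ)) (b := 1)).exists_isMinOn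
    ⟨0, by norm_num⟩ hφ.continuous.continuousOn
  obtain ⟨c, hc⟩ : ∃ c : ℝ, (c : EReal) ≤ φ s₀ := by
    by_cases h : φ s₀ = ⊤
    · exact ⟨0, by simp [h]⟩
    · exact ⟨(φ s₀).toReal, EReal.coe_toReal_le (hφ.ne_bot _)⟩
  refine ⟨max 0 (max (-c) M), le_max_left _ _, fun s => ?_⟩
  by_cases hs : s ∈ Icc (-1 : ℝ) 1
  · refine le_trans ?_ (hc.trans (hs₀ hs))
    have : -c ≤ max 0 (max (-c) M) := (le_max_left _ _).trans (le_max_right _ _)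
    exact_mod_cast (by linarith : -max 0 (max (-c) M) ≤ c)
  · have h1 : 1 ≤ |s| := by
      by_contra! hlt
      exact hs ⟨(abs_lt.1 hlt).1.le, (abs_lt.1 hlt).2.le⟩
    have h2 := (abs_le.1 (hM s h1)).1
    have : M ≤ max 0 (max (-c) M) := (le_max_right _ _).trans (le_max_right _ _)
    refine le_trans ?_ (EReal.coe_toReal_le (hφ.ne_bot s))
    exact_mod_cast (by linarith : -max 0 (max (-c) M) ≤ (φ s).toReal)

section
variable {φ : ℝ → EReal} {C : ℝ}

theorem neg_le_toReal (hC : ∀ s, ((-C : ℝ) : EReal) ≤ φ s) {t : ℝ} (ht : φ t ≠ ⊤) :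
    -C ≤ (φ t).toReal :=
  EReal.coe_le_coe_iff.1 ((hC t).trans (EReal.le_coe_toReal ht))

theorem bddBelow_lipApprox (hC : ∀ s, ((-C : ℝ) : EReal) ≤ φ s) (n : ℕ) (s : ℝ) :
    BddBelow (range fun t : {t : ℝ // φ t ≠ ⊤} => (φ t).toReal + n * |s - t|) := by
  refine ⟨-C, ?_⟩
  rintro _ ⟨t, rfl⟩
  have := neg_le_toReal hC t.2
  have : 0 ≤ n * |s - t| := by positivity
  dsimp only
  linarith

theorem lipApprox_le (hC : ∀ s, ((-C : ℝ) : EReal) ≤ φ s) (n : ℕ) {s : ℝ} (hs : φ s ≠ ⊤) :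
    lipApprox φ n s ≤ (φ s).toReal := by
  refine (ciInf_le (bddBelow_lipApprox hC n s) ⟨s, hs⟩).trans ?_
  simp

theorem Admissible.nonempty_ne_top (hφ : Admissible φ) : Nonempty {t : ℝ // φ t ≠ ⊤} :=
  ⟨⟨1, hφ.ne_top 1 one_ne_zero⟩⟩

theorem neg_le_lipApprox (hφ : Admissible φ) (hC : ∀ s, ((-C : ℝ) : EReal) ≤ φ s)
    (n : ℕ) (s : ℝ) : -C ≤ lipApprox φ n s := by
  have := hφ.nonempty_ne_top
  refine le_ciInf fun t => ?_
  have := neg_le_toReal hC t.2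
  have : 0 ≤ n * |s - t| := by positivity
  linarith

theorem lipschitzWith_lipApprox (hφ : Admissible φ) (hC : ∀ s, ((-C : ℝ) : EReal) ≤ φ s)
    (n : ℕ) : LipschitzWith n (lipApprox φ n) := by
  have := hφ.nonempty_ne_top
  refine LipschitzWith.of_le_add_mul _ fun s s' => ?_
  rw [← sub_le_iff_le_add]
  refine le_ciInf fun t => ?_
  rw [sub_le_iff_le_add]
  refine (ciInf_le (bddBelow_lipApprox hC n s) t).trans ?_
  have h1 : |s - t| ≤ |s' - t| + |s - s'| := by
    have := abs_sub_le s s' t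
    linarith
  have := mul_le_mul_of_nonneg_left h1 (Nat.cast_nonneg (α := ℝ) n)
  rw [Real.dist_eq]
  push_cast
  linarith

/-- From below, points `t` near `s` have `φ t` large by continuity, and far ones pay a penalty of at
least `k n * (δ / 2)`. From above, `φ_n ≤ φ` suffices. The argument `σ n` moves with `n` because it
will be `v_n(x)`; the value `φ s = ⊤` is included. -/
theorem tendsto_lipApprox (hφ : Admissible φ) (hC : ∀ s, ((-C : ℝ) : EReal) ≤ φ s)
    {k : ℕ → ℕ} (hk : Tendsto k atTop atTop) {σ : ℕ → ℝ} {s : ℝ}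
    (hσ : Tendsto σ atTop (𝓝 s)) :
    Tendsto (fun n => (lipApprox φ (k n) (σ n) : EReal)) atTop (𝓝 (φ s)) := by
  have hne := hφ.nonempty_ne_top
  refine tendsto_order.2 ⟨fun c hc => ?_, fun c hc => ?_⟩
  · obtain ⟨d, hcd, hds⟩ := EReal.lt_iff_exists_real_btwn.1 hc
    obtain ⟨δ, hδ, hball⟩ := Metric.eventually_nhds_iff.1
      (hφ.continuous.continuousAt.eventually (lt_mem_nhds hds))
    have hev1 : ∀ᶠ n in atTop, dist (σ n) s < δ / 2 :=
      (tendsto_iff_dist_tendsto_zero.1 hσ).eventually (gt_mem_nhds (half_pos hδ))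
    -- Beyond this threshold the penalty lifts the lower bound `-C` above `d`.
    have hev2 : ∀ᶠ n in atTop, (d + C) / (δ / 2) ≤ (k n : ℝ) :=
      (tendsto_natCast_atTop_atTop.comp hk).eventually (eventually_ge_atTop _)
    filter_upwards [hev1, hev2] with n h1 h2
    refine hcd.trans_le (EReal.coe_le_coe_iff.2 (le_ciInf fun t => ?_))
    rw [div_le_iff₀ (half_pos hδ)] at h2
    by_cases ht : dist (t : ℝ) s < δ
    · have h3 : d < (φ t).toReal :=
        EReal.coe_lt_coe_iff.1 ((hball ht).trans_le (EReal.le_coe_toReal t.2))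
      have : 0 ≤ k n * |σ n - t| := by positivity
      linarith
    · have h3 : δ / 2 ≤ |σ n - t| := by
        have := dist_triangle_left (t : ℝ) s (σ n)
        rw [Real.dist_eq (σ n) t] at this
        linarith
      have h4 := mul_le_mul_of_nonneg_left h3 (Nat.cast_nonneg (α := ℝ) (k n))
      have := neg_le_toReal hC t.2
      linarith
  · filter_upwards [(hφ.continuous.continuousAt.tendsto.comp hσ).eventually (gt_mem_nhds hc)]
      with n hn
    have hn' : φ (σ n) ≠ ⊤ := (lt_of_lt_of_le hn le_top).ne
    refine lt_of_le_of_lt ?_ hn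
    exact (EReal.coe_le_coe_iff.2 (lipApprox_le hC (k n) hn')).trans
      (EReal.coe_toReal_le (hφ.ne_bot _))

theorem abs_lipApprox_le (hφ : Admissible φ) (hC0 : 0 ≤ C) (hC : ∀ s, ((-C : ℝ) : EReal) ≤ φ s)
    (n : ℕ) {s : ℝ} (hs : φ s ≠ ⊤) : |lipApprox φ n s| ≤ |(φ s).toReal| + C := by
  have hC' := neg_le_lipApprox hφ hC n s
  have h1 := lipApprox_le hC n hs
  have h2 := neg_le_toReal hC hs
  have h3 := le_abs_self (φ s).toReal
  have h4 := neg_abs_le (φ s).toReal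
  rw [abs_le]
  have h5 := abs_nonneg (φ s).toReal
  exact ⟨by linarith, by linarith⟩

theorem Admissible.intervalIntegrable (hφ : Admissible φ) (x y : ℝ) :
    IntervalIntegrable (fun t => (φ t).toReal) volume x y := by
  have hm : Measurable fun t => (φ t).toReal := hφ.continuous.measurable.ereal_toReal
  obtain ⟨M, hM⟩ := hφ.bounded (1 / 2) (by norm_num)
  have h0 : IntegrableOn (fun t => (φ t).toReal) (Ioo (-(1 / 2)) (1 / 2)) volume := by
    have hU : Ioo (-(1 / 2) : ℝ) (1 / 2) ⊆ Ioo (-(1 / 2)) 0 ∪ {0} ∪ Ioo 0 (1 / 2) := by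
      intro t ht
      rcases lt_trichotomy t 0 with h | h | h
      · exact Or.inl (Or.inl ⟨ht.1, h⟩)
      · exact Or.inl (Or.inr h)
      · exact Or.inr ⟨h, ht.2⟩
    refine IntegrableOn.mono_set ?_ hU
    exact ((hφ.integrable_left (1 / 2) (by norm_num) (by norm_num)).union
      (by simp)).union (hφ.integrable_right (1 / 2) (by norm_num) (by norm_num))
  rw [intervalIntegrable_iff]
  have hsplit : uIoc x y = (uIoc x y ∩ Ioo (-(1 / 2)) (1 / 2)) ∪
      (uIoc x y \ Ioo (-(1 / 2)) (1 / 2)) := (inter_union_sdiff _ _).symm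
  rw [hsplit]
  refine (h0.mono_set inter_subset_right).union ?_
  refine Measure.integrableOn_of_bounded (M := M) ?_ hm.aestronglyMeasurable ?_
  · exact ((measure_mono sdiff_subset).trans_lt (by simp [uIoc])).ne
  · refine (ae_restrict_iff' (measurableSet_uIoc.diff measurableSet_Ioo)).2
      (ae_of_all _ fun t ht => hM t ?_)
    by_contra! hlt
    exact ht.2 ⟨(abs_lt.1 hlt).1, (abs_lt.1 hlt).2⟩

end

/-! ### Chain rule and a priori estimates. -/

open AbsolutelyContinuousOnInterval in
theorem _root_.LipschitzOnWith.comp_absolutelyContinuousOnInterval {f g : ℝ → ℝ} {a b : ℝ}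
    {K : ℝ≥0} {s : Set ℝ} (hg : LipschitzOnWith K g s)
    (hf : AbsolutelyContinuousOnInterval f a b) (hs : MapsTo f (uIcc a b) s) :
    AbsolutelyContinuousOnInterval (g ∘ f) a b := by
  refine squeeze_zero' ?_ ?_ (by simpa using Tendsto.const_mul (K : ℝ) hf)
  · exact Eventually.of_forall fun E => Finset.sum_nonneg fun _ _ => dist_nonneg
  · refine eventually_inf_principal.2 (Eventually.of_forall fun E hE => ?_)
    rw [Finset.mul_sum]
    refine Finset.sum_le_sum fun i hi => ?_
    exact hg.dist_le_mul _ (hs (hE.1 i hi).1) _ (hs (hE.1 i hi).2)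

/-- Change of variables `∫ g(v) v' = ∫ g` along an absolutely continuous function. -/
theorem integral_comp_primitive_mul {g v w : ℝ → ℝ} {L : ℝ} (hL : 0 ≤ L) (hg : Continuous g)
    (hw : IntervalIntegrable w volume 0 L) (hv : ∀ x ∈ Icc 0 L, v x = ∫ t in (0 : ℝ)..x, w t) :
    ∫ t in (0 : ℝ)..L, g (v t) * w t = ∫ s in (0 : ℝ)..v L, g s := by
  set V : ℝ → ℝ := fun x => ∫ t in (0 : ℝ)..x, w t with hV
  set Φ : ℝ → ℝ := fun s => ∫ r in (0 : ℝ)..s, g r with hΦ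
  have hΦd : ∀ s, HasDerivAt Φ (g s) s := fun s =>
    integral_hasDerivAt_right (hg.intervalIntegrable _ _)
      (hg.stronglyMeasurableAtFilter _ _) hg.continuousAt
  have hVac : AbsolutelyContinuousOnInterval V 0 L :=
    hw.absolutelyContinuousOnInterval_intervalIntegral (by simp)
  obtain ⟨R, hR⟩ := hVac.exists_bound
  obtain ⟨C, hC⟩ := (isCompact_Icc (a := -R) (b := R)).exists_bound_of_continuousOn
    hg.continuousOn
  -- `Φ` need not be globally Lipschitz; the bounded range of `V` is enough for `Φ ∘ V` to be
  -- absolutely continuous.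
  have hlip : LipschitzOnWith C.toNNReal Φ (Icc (-R) R) := by
    refine (convex_Icc _ _).lipschitzOnWith_of_nnnorm_hasDerivWithin_le
      (fun s _ => (hΦd s).hasDerivWithinAt) fun s hs => ?_
    exact NNReal.le_toNNReal_of_coe_le (hC s hs)
  have hac : AbsolutelyContinuousOnInterval (Φ ∘ V) 0 L :=
    hlip.comp_absolutelyContinuousOnInterval hVac fun x hx => abs_le.1 (hR x hx)
  have hFTC := hac.integral_deriv_eq_sub
  have hV0 : V 0 = 0 := by simp [hV]
  have hΦ0 : Φ 0 = 0 := by simp [hΦ]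
  rw [Function.comp_apply, Function.comp_apply, hV0, hΦ0, sub_zero] at hFTC
  rw [hv L ⟨hL, le_rfl⟩]
  refine Eq.trans ?_ hFTC
  refine integral_congr_ae ?_
  filter_upwards [hw.ae_hasDerivAt_integral] with x hx hxm
  have hx' := uIoc_subset_uIcc hxm
  have hd := (hΦd (V x)).comp x (hx hx' 0 (by simp))
  rw [hd.deriv, hv x (by rwa [uIcc_of_le hL] at hx')]

theorem neg_integral_le_of_neg_le {v w ψ : ℝ → ℝ} {L : ℝ}
    (hw : ∀ x y, IntervalIntegrable w volume x y) (hψ : ∀ x y, IntervalIntegrable ψ volume x y)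
    (hψ0 : ∀ t, 0 ≤ ψ t) (hv : ∀ x ∈ Icc 0 L, v x = ∫ t in (0 : ℝ)..x, w t)
    (hle : ∀ t, -ψ t ≤ w t) {x : ℝ} (hx : x ∈ Icc 0 L) :
    -∫ t in (0 : ℝ)..L, ψ t ≤ v x := by
  have h1 : ∫ t in (0 : ℝ)..x, ψ t ≤ ∫ t in (0 : ℝ)..L, ψ t :=
    integral_mono_interval le_rfl hx.1 hx.2 (ae_of_all _ hψ0) (hψ _ _)
  have h2 : ∫ t in (0 : ℝ)..x, -ψ t ≤ ∫ t in (0 : ℝ)..x, w t :=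
    integral_mono hx.1 (hψ _ _).neg (hw _ _) hle
  rw [intervalIntegral.integral_neg] at h2
  rw [hv x hx]
  linarith

/-- Integrate only from the last point `y ≤ x` with `v y ≤ 1`: after it `v > 1`, so the bound on `w`
applies. This keeps the estimate away from the singularity at `0`. -/
theorem le_one_add_integral_of_le {v w ψ : ℝ → ℝ} {L : ℝ} (hvc : Continuous v)
    (hw : ∀ x y, IntervalIntegrable w volume x y) (hψ : ∀ x y, IntervalIntegrable ψ volume x y)
    (hψ0 : ∀ t, 0 ≤ ψ t) (hv : ∀ x ∈ Icc 0 L, v x = ∫ t in (0 : ℝ)..x, w t)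
    (hle : ∀ t, 1 ≤ v t → w t ≤ ψ t) {x : ℝ} (hx : x ∈ Icc 0 L) :
    v x ≤ 1 + ∫ t in (0 : ℝ)..L, ψ t := by
  have hnn : ∀ {y z : ℝ}, 0 ≤ y → y ≤ z → z ≤ L →
      ∫ t in y..z, ψ t ≤ ∫ t in (0 : ℝ)..L, ψ t := fun hy hyz hz =>
    integral_mono_interval hy hyz hz (ae_of_all _ hψ0) (hψ _ _)
  have hv0 : v 0 = 0 := by rw [hv 0 ⟨le_rfl, hx.1.trans hx.2⟩, integral_same]
  have hcomp : IsCompact (Icc 0 x ∩ v ⁻¹' Iic 1) :=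
    isCompact_Icc.inter_right (isClosed_Iic.preimage hvc)
  obtain ⟨y, hy, hmax⟩ := hcomp.exists_isMaxOn
    ⟨0, ⟨le_rfl, hx.1⟩, by simp [hv0]⟩ continuousOn_id
  have hyL : y ∈ Icc 0 L := ⟨hy.1.1, hy.1.2.trans hx.2⟩
  have hsub : v x - v y = ∫ t in y..x, w t := by
    rw [hv x hx, hv y hyL, integral_interval_sub_left (hw _ _) (hw _ _)]
  have hle' : ∫ t in y..x, w t ≤ ∫ t in y..x, ψ t := by
    refine integral_mono_on_of_le_Ioo hy.1.2 (hw _ _) (hψ _ _) fun t ht => hle t ?_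
    by_contra! hlt
    exact absurd (hmax ⟨⟨hy.1.1.trans ht.1.le, ht.2.le⟩, hlt.le⟩) (not_le.2 ht.1)
  have h1 : v y ≤ 1 := hy.2
  have := hnn hy.1.1 hy.1.2 hx.2
  linarith

/-- Hölder continuity of functions whose derivative is square integrable. -/
theorem abs_sub_le_sqrt_of_integral_sq_le {v w : ℝ → ℝ} {L K : ℝ} (hL : 0 ≤ L)
    (hw : ∀ x y, IntervalIntegrable w volume x y)
    (hw2 : IntervalIntegrable (fun t => w t ^ 2) volume 0 L)
    (hK : ∫ t in (0 : ℝ)..L, w t ^ 2 ≤ K)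
    (hv : ∀ x ∈ Icc 0 L, v x = ∫ t in (0 : ℝ)..x, w t) {x y : ℝ} (hx : x ∈ Icc 0 L)
    (hy : y ∈ Icc 0 L) : |v x - v y| ≤ (K + 1) / 2 * √|x - y| := by
  wlog hxy : y < x generalizing x y
  · rcases (not_lt.1 hxy).eq_or_lt with h | h
    · simp [h]
    · rw [abs_sub_comm, abs_sub_comm x]
      exact this hy hx h
  have hpos : 0 < x - y := sub_pos.2 hxy
  rw [abs_of_pos hpos]
  set c := √(x - y) with hc
  have hc0 : 0 < c := Real.sqrt_pos.2 hpos
  have hcc : c * c = x - y := Real.mul_self_sqrt hpos.le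
  have hw2' : IntervalIntegrable (fun t => w t ^ 2) volume y x :=
    hw2.mono_set (by rw [uIcc_of_le hxy.le, uIcc_of_le hL]; exact Icc_subset_Icc hy.1 hx.2)
  have hsub : v x - v y = ∫ t in y..x, w t := by
    rw [hv x hx, hv y hy, integral_interval_sub_left (hw _ _) (hw _ _)]
  rw [hsub, ← Real.norm_eq_abs]
  -- Young's inequality with weight `c = √(x - y)` in place of Cauchy–Schwarz; both terms then
  -- integrate to multiples of `c`.
  have h1 : ‖∫ t in y..x, w t‖ ≤ ∫ t in y..x, (c / 2 * w t ^ 2 + 1 / (2 * c)) := by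
    refine norm_integral_le_of_norm_le hxy.le (ae_of_all _ fun t _ => ?_)
      ((hw2'.const_mul _).add intervalIntegrable_const)
    rw [Real.norm_eq_abs, ← sq_abs (w t)]
    have : c / 2 * |w t| ^ 2 + 1 / (2 * c) - |w t| = (c * |w t| - 1) ^ 2 / (2 * c) := by
      field_simp; ring
    have : 0 ≤ (c * |w t| - 1) ^ 2 / (2 * c) := by positivity
    linarith
  have h2 : ∫ t in y..x, w t ^ 2 ≤ K :=
    (integral_mono_interval hy.1 hxy.le hx.2 (ae_of_all _ fun t => sq_nonneg _) hw2).trans hK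
  rw [intervalIntegral.integral_add (hw2'.const_mul _) intervalIntegrable_const,
    intervalIntegral.integral_const_mul, intervalIntegral.integral_const, smul_eq_mul,
    ← hcc] at h1
  have h3 : c * c * (1 / (2 * c)) = c / 2 := by field_simp
  rw [h3] at h1
  have h4 := mul_le_mul_of_nonneg_left h2 (half_pos hc0).le
  linarith

/-- The energy estimate for `a v' = g(v) + h`, tested against `g(v)`. -/
theorem integral_sq_le_of_energy {G a h : ℝ → ℝ} {L α β E : ℝ} (hL : 0 ≤ L) (hα : 0 < α)
    (hαβ : α ≤ β) (ha : ∀ t, α ≤ a t ∧ a t ≤ β)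
    (hG2 : IntervalIntegrable (fun t => G t ^ 2) volume 0 L)
    (hh2 : IntervalIntegrable (fun t => h t ^ 2) volume 0 L)
    (hGw : IntervalIntegrable (fun t => G t * ((G t + h t) / a t)) volume 0 L)
    (hE : ∫ t in (0 : ℝ)..L, G t * ((G t + h t) / a t) ≤ E) :
    ∫ t in (0 : ℝ)..L, G t ^ 2 ≤
      2 * β * (E + β / (2 * α ^ 2) * ∫ t in (0 : ℝ)..L, h t ^ 2) := by
  have hβ : 0 < β := hα.trans_le hαβ
  have hpt : ∀ t, G t ^ 2 ≤
      2 * β * (G t * ((G t + h t) / a t) + β / (2 * α ^ 2) * h t ^ 2) := by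
    intro t
    have ha0 : 0 < a t := hα.trans_le (ha t).1
    have h1 : G t * ((G t + h t) / a t) = G t ^ 2 / a t + G t * (h t / a t) := by
      field_simp
    have h2 : G t ^ 2 / β ≤ G t ^ 2 / a t :=
      div_le_div_of_nonneg_left (sq_nonneg _) ha0 (ha t).2
    have h3 : (h t / a t) ^ 2 ≤ h t ^ 2 / α ^ 2 := by
      rw [div_pow]
      exact div_le_div_of_nonneg_left (sq_nonneg _) (by positivity)
        (pow_le_pow_left₀ hα.le (ha t).1 2)
    -- Young with weight `β`, so that the cross term absorbs only half of `G² / β`.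
    have h4 : -(G t * (h t / a t)) ≤ G t ^ 2 / (2 * β) + β / 2 * (h t / a t) ^ 2 := by
      have : G t ^ 2 / (2 * β) + β / 2 * (h t / a t) ^ 2 + G t * (h t / a t) =
          (G t + β * (h t / a t)) ^ 2 / (2 * β) := by field_simp; ring
      have : 0 ≤ (G t + β * (h t / a t)) ^ 2 / (2 * β) := by positivity
      linarith
    have h5 := mul_le_mul_of_nonneg_left h3 (half_pos hβ).le
    have h6 : β / 2 * (h t ^ 2 / α ^ 2) = β / (2 * α ^ 2) * h t ^ 2 := by field_simp
    have h7 : G t ^ 2 = 2 * β * (G t ^ 2 / β - G t ^ 2 / (2 * β)) := by field_simp; ring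
    rw [h7]
    refine mul_le_mul_of_nonneg_left ?_ (by positivity)
    rw [h1]
    linarith
  refine (integral_mono hL hG2 ((hGw.add (hh2.const_mul _)).const_mul _) hpt).trans ?_
  rw [intervalIntegral.integral_const_mul,
    intervalIntegral.integral_add hGw (hh2.const_mul _), intervalIntegral.integral_const_mul]
  gcongr

/-! ### Compactness: Arzelà–Ascoli, Fatou and Vitali. -/

theorem exists_subseq_tendsto_of_sqrt_holder {L R H : ℝ} (hL : 0 ≤ L) {v : ℕ → ℝ → ℝ}
    (hR : ∀ n, ∀ x ∈ Icc 0 L, |v n x| ≤ R)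
    (hH : ∀ n, ∀ x ∈ Icc 0 L, ∀ y ∈ Icc 0 L, |v n x - v n y| ≤ H * √|x - y|) :
    ∃ (u : ℝ → ℝ) (k : ℕ → ℕ), Continuous u ∧ StrictMono k ∧
      ∀ x ∈ Icc 0 L, Tendsto (fun n => v (k n) x) atTop (𝓝 (u x)) := by
  have hlim : ∀ x : Icc 0 L, Tendsto (fun y : Icc 0 L => H * √|(x : ℝ) - y|) (𝓝 x) (𝓝 0) := by
    intro x
    have : Continuous fun y : Icc 0 L => H * √|(x : ℝ) - y| := by fun_prop
    simpa using this.tendsto x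
  have hcont : ∀ n, Continuous fun x : Icc 0 L => v n x := fun n =>
    continuous_iff_continuousAt.2 fun x => by
      rw [ContinuousAt, tendsto_iff_dist_tendsto_zero]
      refine squeeze_zero (fun _ => dist_nonneg) (fun y => ?_) (hlim x)
      rw [dist_comm, Real.dist_eq]
      exact hH n x x.2 y y.2
  let F : ℕ → BoundedContinuousFunction (Icc 0 L) ℝ := fun n =>
    BoundedContinuousFunction.mkOfCompact ⟨fun x => v n x, hcont n⟩
  have hequi : Equicontinuous ((↑) : range F → Icc 0 L → ℝ) := by
    intro x
    refine Metric.equicontinuousAt_of_continuity_modulus _ (hlim x) _ ?_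
    refine Eventually.of_forall fun y => ?_
    rintro ⟨_, n, rfl⟩
    exact hH n x x.2 y y.2
  have hcomp := BoundedContinuousFunction.arzela_ascoli (Icc (-R) R) isCompact_Icc (range F)
    (by rintro _ x ⟨n, rfl⟩; exact abs_le.1 (hR n x x.2)) hequi
  obtain ⟨u, -, k, hk, hu⟩ := hcomp.tendsto_subseq fun n => subset_closure (mem_range_self n)
  refine ⟨IccExtend hL u, k, u.continuous.Icc_extend', hk, fun x hx => ?_⟩
  rw [IccExtend_of_mem hL _ hx]
  exact (BoundedContinuousFunction.tendsto_iff_tendstoUniformly.1 hu).tendsto_at ⟨x, hx⟩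

/-- By Hölder, the `L¹` norm over `s` is at most `K μ(s)^(1/2)`. Taking `K + 1` in the choice of `δ`
avoids dividing by zero. -/
theorem unifIntegrable_one_of_eLpNorm_two_le {X : Type*} [MeasurableSpace X] {μ : Measure X}
    {g : ℕ → X → ℝ} {K : ℝ≥0}
    (hg : ∀ n, AEStronglyMeasurable (g n) μ) (hK : ∀ n, eLpNorm (g n) 2 μ ≤ K) :
    UnifIntegrable g 1 μ := by
  intro ε hε
  refine ⟨(ε / (K + 1)) ^ 2, by positivity, fun n s hs hμ => ?_⟩
  rw [eLpNorm_indicator_eq_eLpNorm_restrict hs]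
  have h1 := eLpNorm_le_eLpNorm_mul_rpow_measure_univ (p := 1) (q := 2) (by norm_num)
    (hg n).restrict (μ := μ.restrict s)
  refine h1.trans ?_
  rw [Measure.restrict_apply_univ]
  have h2 : eLpNorm (g n) 2 (μ.restrict s) ≤ K :=
    (eLpNorm_mono_measure _ Measure.restrict_le_self).trans (hK n)
  have h3 : μ s ^ (1 / (1 : ℝ≥0∞).toReal - 1 / (2 : ℝ≥0∞).toReal) ≤
      ENNReal.ofReal (ε / (K + 1)) := by
    have he : (1 / (1 : ℝ≥0∞).toReal - 1 / (2 : ℝ≥0∞).toReal) = 1 / 2 := by norm_num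
    rw [he]
    refine (ENNReal.rpow_le_rpow hμ (by norm_num)).trans ?_
    rw [ENNReal.ofReal_rpow_of_nonneg (by positivity) (by norm_num), ← Real.sqrt_eq_rpow,
      Real.sqrt_sq (by positivity)]
  refine (mul_le_mul' h2 h3).trans ?_
  rw [← ENNReal.ofReal_coe_nnreal, ← ENNReal.ofReal_mul (NNReal.coe_nonneg K)]
  refine ENNReal.ofReal_le_ofReal ?_
  have hK0 := NNReal.coe_nonneg K
  rw [mul_div_assoc', div_le_iff₀ (by positivity)]
  nlinarith

/-- A sequence bounded in `L²` and converging pointwise in the extended reals to a limit that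
avoids `-∞` has a limit in `L²`, and converges to it in `L¹`. -/
theorem tendsto_of_eLpNorm_two_le_of_tendsto_ereal {X : Type*} [MeasurableSpace X]
    {μ : Measure X} [IsFiniteMeasure μ] {g : ℕ → X → ℝ}
    {ψ : X → EReal} {K : ℝ≥0} (hg : ∀ n, Measurable (g n)) (hK : ∀ n, eLpNorm (g n) 2 μ ≤ K)
    (hbot : ∀ x, ψ x ≠ ⊥)
    (hlim : ∀ᵐ x ∂μ, Tendsto (fun n => (g n x : EReal)) atTop (𝓝 (ψ x))) :
    (∀ᵐ x ∂μ, ψ x ≠ ⊤ ∧ ψ x ≠ ⊥) ∧ MemLp (fun x => (ψ x).toReal) 2 μ ∧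
      Tendsto (fun n => eLpNorm (g n - fun x => (ψ x).toReal) 1 μ) atTop (𝓝 0) := by
  -- Where `ψ = ⊤` one has `|g n| → ∞`, while the `L²` bound makes the lower limit of `|g n|` finite
  -- a.e.
  have hfin : ∀ᵐ x ∂μ, ψ x ≠ ⊤ := by
    filter_upwards [ae_bdd_liminf_atTop_of_eLpNorm_bdd two_ne_zero hg hK, hlim] with x hx hl htop
    rw [htop] at hl
    have h1 : Tendsto (fun n => g n x) atTop atTop := EReal.tendsto_coe_nhds_top_iff.1 hl
    have h2 : Tendsto (fun n => ‖g n x‖ₑ) atTop (𝓝 ⊤) := by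
      refine tendsto_of_tendsto_of_tendsto_of_le_of_le
        (ENNReal.tendsto_ofReal_atTop.comp h1) tendsto_const_nhds (fun n => ?_) fun n => le_top
      rw [← ofReal_norm]
      exact ENNReal.ofReal_le_ofReal (le_abs_self _)
    rw [h2.liminf_eq] at hx
    exact lt_irrefl _ hx
  have hreal : ∀ᵐ x ∂μ, Tendsto (fun n => g n x) atTop (𝓝 (ψ x).toReal) := by
    filter_upwards [hfin, hlim] with x hx hl
    exact (EReal.tendsto_toReal hx (hbot x)).comp hl
  have hmeas : ∀ n, AEStronglyMeasurable (g n) μ := fun n => (hg n).aestronglyMeasurable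
  have hψm : AEStronglyMeasurable (fun x => (ψ x).toReal) μ :=
    aestronglyMeasurable_of_tendsto_ae atTop hmeas hreal
  have hψ2 : MemLp (fun x => (ψ x).toReal) 2 μ := by
    refine ⟨hψm, lt_of_le_of_lt (Lp.eLpNorm_lim_le_liminf_eLpNorm hmeas _ hreal) ?_⟩
    refine lt_of_le_of_lt (liminf_le_of_le (by isBoundedDefault) (a := (K : ℝ≥0∞)) ?_)
      ENNReal.coe_lt_top
    intro b hb
    obtain ⟨n, hn⟩ := hb.exists
    exact hn.trans (hK n)
  refine ⟨hfin.mono fun x hx => ⟨hx, hbot x⟩, hψ2, ?_⟩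
  exact tendsto_Lp_finite_of_tendsto_ae le_rfl ENNReal.one_ne_top hmeas
    (hψ2.mono_exponent (by norm_num)) (unifIntegrable_one_of_eLpNorm_two_le hmeas hK) hreal

/-! ### From the integral equation to the weak derivative. -/

theorem intervalIntegral_eq_integral_leb (L : ℝ) (hL : 0 ≤ L) (f : ℝ → ℝ) :
    ∫ t in (0 : ℝ)..L, f t = ∫ t, f t ∂(leb L) := by
  rw [integral_of_le hL, integral_Ioc_eq_integral_Ioo]

theorem intervalIntegrable_iff_integrable_leb {L : ℝ} (hL : 0 ≤ L) {f : ℝ → ℝ} :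
    IntervalIntegrable f volume 0 L ↔ Integrable f (leb L) := by
  rw [intervalIntegrable_iff_integrableOn_Ioo_of_le hL, IntegrableOn]

/-- Integration by parts for absolutely continuous functions; the boundary terms vanish with `η`. -/
theorem hasH1Deriv_of_eq_integral {L : ℝ} (hL : 0 ≤ L) {v w : ℝ → ℝ} (hvc : Continuous v)
    (hw : MemLp w 2 (leb L)) (hv : ∀ x ∈ Icc 0 L, v x = ∫ t in (0 : ℝ)..x, w t) :
    HasH1Deriv L v w := by
  refine ⟨?_, hw, fun η => ?_⟩
  · obtain ⟨C, hC⟩ := (isCompact_Icc (a := 0) (b := L)).exists_bound_of_continuousOn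
      hvc.continuousOn
    exact MemLp.of_bound hvc.aestronglyMeasurable C
      ((ae_restrict_iff' measurableSet_Ioo).2 (ae_of_all _ fun t ht => hC t ⟨ht.1.le, ht.2.le⟩))
  · have hwi : IntervalIntegrable w volume 0 L :=
      (intervalIntegrable_iff_integrable_leb hL).2 (hw.integrable (by norm_num))
    have hVac := hwi.absolutelyContinuousOnInterval_intervalIntegral (c := 0) (by simp)
    have hηac : AbsolutelyContinuousOnInterval η 0 L :=
      (η.contDiff.of_le (by simp)).contDiffOn.absolutelyContinuousOnInterval
    have hη : ∀ x, x ∉ Ioo 0 L → η x = 0 := fun x hx =>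
      image_eq_zero_of_notMem_tsupport fun h => hx (η.tsupport_subset h)
    have hparts := hVac.integral_mul_deriv_eq_deriv_mul hηac
    rw [hη 0 (by simp), hη L (by simp), mul_zero, mul_zero, sub_zero, zero_sub] at hparts
    rw [← intervalIntegral_eq_integral_leb L hL, ← intervalIntegral_eq_integral_leb L hL]
    refine Eq.trans ?_ (hparts.trans ?_)
    · refine integral_congr fun x hx => ?_
      rw [uIcc_of_le hL] at hx
      simp only [hv x hx]
    · congr 1
      refine integral_congr_ae ?_
      filter_upwards [hwi.ae_hasDerivAt_integral] with x hx hxm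
      rw [(hx (uIoc_subset_uIcc hxm) 0 (by simp)).deriv]

/-! ### Estimates uniform in the regularization. -/

/-- This is where integrability of `φ` across `0` enters the energy bound. The pointwise bound
`|φ_n| ≤ |φ| + C` may fail at `0`, where `toReal` sends `⊤` to `0`, so that null point is discarded.
-/
theorem Admissible.abs_integral_lipApprox_le {φ : ℝ → EReal} (hφ : Admissible φ) {C : ℝ}
    (hC0 : 0 ≤ C) (hC : ∀ s, ((-C : ℝ) : EReal) ≤ φ s) (n : ℕ) {R y : ℝ} (hy : |y| ≤ R) :
    |∫ s in (0 : ℝ)..y, lipApprox φ n s| ≤ ∫ s in (-R)..R, (|(φ s).toReal| + C) := by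
  have hR : -R ≤ R := neg_le_self ((abs_nonneg y).trans hy)
  have hi : IntervalIntegrable (fun s => |(φ s).toReal| + C) volume (-R) R :=
    (hφ.intervalIntegrable _ _).abs.add intervalIntegrable_const
  have hi' := (intervalIntegrable_iff_integrableOn_Ioc_of_le hR).1 hi
  have hsub : uIoc 0 y ⊆ Ioc (-R) R := by
    intro t ht
    obtain ⟨h1, h2⟩ := abs_le.1 hy
    rcases le_total 0 y with h | h
    · rw [uIoc_of_le h] at ht
      exact ⟨by linarith [ht.1], ht.2.trans h2⟩
    · rw [uIoc_of_ge h] at ht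
      exact ⟨by linarith [ht.1], by linarith [ht.2]⟩
  have hpos : ∀ s, 0 ≤ |(φ s).toReal| + C := fun s => by positivity
  rw [integral_of_le hR, ← Real.norm_eq_abs]
  refine norm_integral_le_integral_norm_uIoc.trans ?_
  refine le_trans ?_ (setIntegral_mono_set hi' (ae_of_all _ hpos) hsub.eventuallyLE)
  refine setIntegral_mono_ae ?_ (hi'.mono_set hsub) ?_
  · exact (intervalIntegrable_iff.1
      ((lipschitzWith_lipApprox hφ hC n).continuous.intervalIntegrable 0 y)).norm
  · have h0 : ∀ᵐ s : ℝ, s ≠ 0 := by simp [ae_iff, measure_singleton]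
    filter_upwards [h0] with s hs
    exact abs_lipApprox_le hφ hC0 hC n (hφ.ne_top s hs)

theorem eLpNorm_two_leb_le_of_integral_sq_le {L K : ℝ} (hL : 0 ≤ L) {g : ℝ → ℝ}
    (hg : MemLp g 2 (leb L)) (hK : ∫ t in (0 : ℝ)..L, g t ^ 2 ≤ K) :
    eLpNorm g 2 (leb L) ≤ ((√K).toNNReal : ℝ≥0) := by
  rw [intervalIntegral_eq_integral_leb L hL] at hK
  rw [hg.eLpNorm_eq_integral_rpow_norm two_ne_zero ENNReal.ofNat_ne_top]
  refine ENNReal.ofReal_le_ofReal ?_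
  simp only [ENNReal.toReal_ofNat, Real.rpow_ofNat, Real.norm_eq_abs, sq_abs]
  rw [← one_div, ← Real.sqrt_eq_rpow]
  exact Real.sqrt_le_sqrt hK

/-- Uniform bounds for the solutions of the regularized problems. -/
theorem exists_bounds_of_regularized {L α β : ℝ} (hL : 0 ≤ L) (hα : 0 < α) (hαβ : α ≤ β)
    {a h : ℝ → ℝ} (ham : AEStronglyMeasurable a volume) (ha : ∀ t, α ≤ a t ∧ a t ≤ β)
    (hh : MemLp h 2 volume) {φ : ℝ → EReal} (hφ : Admissible φ) {C : ℝ} (hC0 : 0 ≤ C)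
    (hC : ∀ s, ((-C : ℝ) : EReal) ≤ φ s) :
    ∃ R K H : ℝ, ∀ (n : ℕ) (v : ℝ → ℝ), Continuous v →
      (∀ x ∈ Icc 0 L, v x = ∫ t in (0 : ℝ)..x, (lipApprox φ n (v t) + h t) / a t) →
      (∀ x ∈ Icc 0 L, |v x| ≤ R) ∧ (∫ t in (0 : ℝ)..L, lipApprox φ n (v t) ^ 2 ≤ K) ∧
      ∀ x ∈ Icc 0 L, ∀ y ∈ Icc 0 L, |v x - v y| ≤ H * √|x - y| := by
  obtain ⟨M, hM⟩ := hφ.bounded 1 one_pos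
  set D := max C M
  have hD0 : 0 ≤ D := hC0.trans (le_max_left _ _)
  have hhi : ∀ x y, IntervalIntegrable h volume x y := fun x y =>
    ((hh.locallyIntegrable (by norm_num)).integrableOn_isCompact isCompact_uIcc).intervalIntegrable
  have hh2 : ∀ x y, IntervalIntegrable (fun t => h t ^ 2) volume x y := fun x y =>
    hh.integrable_sq.intervalIntegrable
  have ham' : AEStronglyMeasurable (fun t => (a t)⁻¹) volume :=
    (ham.aemeasurable.inv).aestronglyMeasurable
  have ha0 : ∀ t, 0 < a t := fun t => hα.trans_le (ha t).1
  have hab : ∀ t, |(a t)⁻¹| ≤ α⁻¹ := fun t => by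
    rw [abs_of_pos (inv_pos.2 (ha0 t))]
    exact inv_anti₀ hα (ha t).1
  set ψ : ℝ → ℝ := fun t => (D + |h t|) / α
  have hψ0 : ∀ t, 0 ≤ ψ t := fun t => by positivity
  have hψi : ∀ x y, IntervalIntegrable ψ volume x y := fun x y =>
    (intervalIntegrable_const.add (hhi x y).abs).div_const _
  -- `R` bounds `|v|`, `E` bounds `∫ φ_n(v) v'`, `K` bounds `∫ φ_n(v)²` by the energy estimate, and
  -- `K'` bounds `∫ v'²` through `(p + q)² ≤ 2p² + 2q²`.
  set R := 1 + ∫ t in (0 : ℝ)..L, ψ t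
  set E := ∫ s in (-R)..R, (|(φ s).toReal| + C)
  set K := 2 * β * (E + β / (2 * α ^ 2) * ∫ t in (0 : ℝ)..L, h t ^ 2)
  set K' := (2 * K + 2 * ∫ t in (0 : ℝ)..L, h t ^ 2) / α ^ 2 with hK'
  refine ⟨R, K, (K' + 1) / 2, fun n v hvc hv => ?_⟩
  have hgc : Continuous (lipApprox φ n) := (lipschitzWith_lipApprox hφ hC n).continuous
  have hGc : Continuous fun t => lipApprox φ n (v t) := hgc.comp hvc
  have hdiv : ∀ f : ℝ → ℝ, ∀ x y, IntervalIntegrable f volume x y →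
      IntervalIntegrable (fun t => f t / a t) volume x y := fun f x y hf => by
    simp only [div_eq_mul_inv]
    rw [intervalIntegrable_iff] at hf ⊢
    exact Integrable.mul_bdd (c := α⁻¹) hf ham'.restrict (ae_of_all _ hab)
  have hwi : ∀ x y, IntervalIntegrable (fun t => (lipApprox φ n (v t) + h t) / a t)
      volume x y := fun x y => hdiv _ x y ((hGc.intervalIntegrable x y).add (hhi x y))
  have habsdiv : ∀ t z, |z| ≤ D + |h t| → |z / a t| ≤ ψ t := fun t z hz => by
    rw [abs_div, abs_of_pos (ha0 t)]
    exact div_le_div₀ (by positivity) hz hα (ha t).1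
  have hlow : ∀ t, -ψ t ≤ (lipApprox φ n (v t) + h t) / a t := fun t => by
    have h1 := neg_le_lipApprox hφ hC n (v t)
    have h2 := neg_abs_le (h t)
    have h3 : C ≤ D := le_max_left _ _
    have h4 : -(D + |h t|) / a t ≤ (lipApprox φ n (v t) + h t) / a t :=
      div_le_div_of_nonneg_right (by linarith) (ha0 t).le
    have h5 := habsdiv t (-(D + |h t|)) (by rw [abs_neg, abs_of_nonneg (by positivity)])
    exact (abs_le.1 h5).1.trans h4
  have hup : ∀ t, 1 ≤ v t → (lipApprox φ n (v t) + h t) / a t ≤ ψ t := fun t ht => by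
    have h1 : lipApprox φ n (v t) ≤ (φ (v t)).toReal :=
      lipApprox_le hC n (hφ.ne_top _ (by linarith))
    have h2 := (abs_le.1 (hM (v t) (ht.trans (le_abs_self _)))).2
    have h3 : M ≤ D := le_max_right _ _
    have h4 := le_abs_self (h t)
    have h5 : (lipApprox φ n (v t) + h t) / a t ≤ (D + |h t|) / a t :=
      div_le_div_of_nonneg_right (by linarith) (ha0 t).le
    have h6 := habsdiv t (D + |h t|) (by rw [abs_of_nonneg (by positivity)])
    exact h5.trans (abs_le.1 h6).2
  have hvR : ∀ x ∈ Icc 0 L, |v x| ≤ R := fun x hx => by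
    have h1 := neg_integral_le_of_neg_le hwi hψi hψ0 hv hlow hx
    have h2 := le_one_add_integral_of_le hvc hwi hψi hψ0 hv hup hx
    exact abs_le.2 ⟨by linarith, h2⟩
  have hG2 : IntervalIntegrable (fun t => lipApprox φ n (v t) ^ 2) volume 0 L :=
    (hGc.pow 2).intervalIntegrable _ _
  have hGK : ∫ t in (0 : ℝ)..L, lipApprox φ n (v t) ^ 2 ≤ K := by
    refine integral_sq_le_of_energy hL hα hαβ ha hG2 (hh2 _ _)
      ((hwi 0 L).continuousOn_mul hGc.continuousOn) ?_
    rw [integral_comp_primitive_mul hL hgc (hwi 0 L) hv]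
    exact (le_abs_self _).trans
      (hφ.abs_integral_lipApprox_le hC0 hC n (hvR L ⟨hL, le_rfl⟩))
  refine ⟨hvR, hGK, ?_⟩
  have hdom : IntervalIntegrable (fun t => (2 * lipApprox φ n (v t) ^ 2 + 2 * h t ^ 2) / α ^ 2)
      volume 0 L := ((hG2.const_mul 2).add ((hh2 _ _).const_mul 2)).div_const _
  have hpt : ∀ t, ((lipApprox φ n (v t) + h t) / a t) ^ 2 ≤
      (2 * lipApprox φ n (v t) ^ 2 + 2 * h t ^ 2) / α ^ 2 := fun t => by
    rw [div_pow]
    refine div_le_div₀ (by positivity) ?_ (by positivity)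
      (pow_le_pow_left₀ hα.le (ha t).1 2)
    linarith [sq_nonneg (lipApprox φ n (v t) - h t),
      add_sq (lipApprox φ n (v t)) (h t), sub_sq (lipApprox φ n (v t)) (h t)]
  have hw2 : IntervalIntegrable (fun t => ((lipApprox φ n (v t) + h t) / a t) ^ 2)
      volume 0 L := by
    refine hdom.mono_fun' ?_ (ae_of_all _ fun t => ?_)
    · exact ((intervalIntegrable_iff.1 (hwi 0 L)).aestronglyMeasurable).pow 2
    · beta_reduce
      rw [Real.norm_eq_abs, abs_of_nonneg (sq_nonneg _)]
      exact hpt t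
  have hwK : ∫ t in (0 : ℝ)..L, ((lipApprox φ n (v t) + h t) / a t) ^ 2 ≤ K' := by
    refine (integral_mono hL hw2 hdom hpt).trans ?_
    rw [intervalIntegral.integral_div,
      intervalIntegral.integral_add (hG2.const_mul 2) ((hh2 _ _).const_mul 2),
      intervalIntegral.integral_const_mul, intervalIntegral.integral_const_mul]
    rw [hK']
    gcongr
  exact fun x hx y hy => abs_sub_le_sqrt_of_integral_sq_le hL hwi hw2 hwK hv hx hy

/-! ### Passage to the limit and conclusion. -/

/-- Existence of a solution in integral form. -/
theorem exists_integral_solution {L α β : ℝ} (hL : 0 ≤ L) (hα : 0 < α) (hαβ : α ≤ β)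
    {a h : ℝ → ℝ} (ham : AEStronglyMeasurable a volume) (ha : ∀ t, α ≤ a t ∧ a t ≤ β)
    (hh : MemLp h 2 volume) {φ : ℝ → EReal} (hφ : Admissible φ) :
    ∃ u : ℝ → ℝ, Continuous u ∧ EMemL2 L (fun x => φ (u x)) ∧
      ∀ x ∈ Icc 0 L, u x = ∫ t in (0 : ℝ)..x, ((φ (u t)).toReal + h t) / a t := by
  obtain ⟨C, hC0, hC⟩ := hφ.exists_lower_bound
  obtain ⟨R, K, H, hbd⟩ := exists_bounds_of_regularized hL hα hαβ ham ha hh hφ hC0 hC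
  have ham' : AEStronglyMeasurable (fun t => (a t)⁻¹) volume :=
    (ham.aemeasurable.inv).aestronglyMeasurable
  have ha0 : ∀ t, 0 < a t := fun t => hα.trans_le (ha t).1
  have hab : ∀ t, |(a t)⁻¹| ≤ α⁻¹ := fun t => by
    rw [abs_of_pos (inv_pos.2 (ha0 t))]
    exact inv_anti₀ hα (ha t).1
  have hki : ∀ x y, IntervalIntegrable (fun t => h t * (a t)⁻¹) volume x y := fun x y => by
    have hhi : IntervalIntegrable h volume x y := ((hh.locallyIntegrable
      (by norm_num)).integrableOn_isCompact isCompact_uIcc).intervalIntegrable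
    rw [intervalIntegrable_iff] at hhi ⊢
    exact Integrable.mul_bdd (c := α⁻¹) hhi ham'.restrict (ae_of_all _ hab)
  have hex : ∀ n : ℕ, ∃ v : ℝ → ℝ, Continuous v ∧ ∀ x ∈ Icc 0 L,
      v x = ∫ t in (0 : ℝ)..x, (lipApprox φ n (v t) + h t) / a t := fun n => by
    obtain ⟨v, hvc, hv⟩ := exists_caratheodory_solution hL
      (lipschitzWith_lipApprox hφ hC n) ham' hab hki
    refine ⟨v, hvc, fun x hx => (hv x hx).trans ?_⟩
    simp only [div_eq_mul_inv, add_mul]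
  choose v hvc hv using hex
  obtain ⟨u, k, huc, hk, hu⟩ := exists_subseq_tendsto_of_sqrt_holder hL
    (fun n => (hbd n (v n) (hvc n) (hv n)).1) (fun n => (hbd n (v n) (hvc n) (hv n)).2.2)
  have hGc : ∀ n, Continuous fun t => lipApprox φ n (v n t) := fun n =>
    (lipschitzWith_lipApprox hφ hC n).continuous.comp (hvc n)
  have hG2 : ∀ n, MemLp (fun t => lipApprox φ n (v n t)) 2 (leb L) := fun n => by
    obtain ⟨B, hB⟩ := (isCompact_Icc (a := 0) (b := L)).exists_bound_of_continuousOn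
      (hGc n).continuousOn
    exact MemLp.of_bound (hGc n).aestronglyMeasurable B
      ((ae_restrict_iff' measurableSet_Ioo).2 (ae_of_all _ fun t ht => hB t ⟨ht.1.le, ht.2.le⟩))
  obtain ⟨hfin, hf2, hL1⟩ := tendsto_of_eLpNorm_two_le_of_tendsto_ereal (μ := leb L)
    (g := fun n t => lipApprox φ (k n) (v (k n) t)) (ψ := fun t => φ (u t))
    (fun n => (hGc (k n)).measurable)
    (fun n => eLpNorm_two_leb_le_of_integral_sq_le hL (hG2 (k n))
      (hbd (k n) (v (k n)) (hvc _) (hv _)).2.1)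
    (fun t => hφ.ne_bot _)
    ((ae_restrict_iff' measurableSet_Ioo).2 (ae_of_all _ fun t ht =>
      tendsto_lipApprox hφ hC hk.tendsto_atTop (hu t ⟨ht.1.le, ht.2.le⟩)))
  refine ⟨u, huc, ⟨hfin, hf2⟩, fun x hx => ?_⟩
  have hdiv : ∀ f : ℝ → ℝ, MemLp f 2 (leb L) →
      Integrable (fun t => (f t + h t) / a t) (leb L) := fun f hf => by
    simp only [div_eq_mul_inv]
    exact Integrable.mul_bdd (c := α⁻¹) ((hf.add (hh.restrict _)).integrable (by norm_num))
      ham'.restrict (ae_of_all _ hab)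
  have hlim : Tendsto (fun n => ∫ t in Ioo 0 x,
      (lipApprox φ (k n) (v (k n) t) + h t) / a t ∂(leb L)) atTop
      (𝓝 (∫ t in Ioo 0 x, ((φ (u t)).toReal + h t) / a t ∂(leb L))) := by
    -- `h` cancels in the difference and `1 / a ≤ α⁻¹`, so `L¹` convergence of `φ_n(v_n)` carries
    -- over to the integrands.
    refine tendsto_setIntegral_of_L1' _ (hdiv _ hf2).1
      (Eventually.of_forall fun n => hdiv _ (hG2 (k n))) ?_ _
    have hz := ENNReal.Tendsto.const_mul (a := ENNReal.ofReal α⁻¹) hL1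
      (Or.inr ENNReal.ofReal_ne_top)
    rw [mul_zero] at hz
    refine tendsto_of_tendsto_of_tendsto_of_le_of_le tendsto_const_nhds hz
      (fun _ => zero_le) fun n => ?_
    refine eLpNorm_le_mul_eLpNorm_of_ae_le_mul (ae_of_all _ fun t => ?_) 1
    simp only [Pi.sub_apply, Real.norm_eq_abs]
    rw [← sub_div, add_sub_add_right_eq_sub, div_eq_mul_inv, abs_mul, mul_comm]
    exact mul_le_mul_of_nonneg_right (hab t) (abs_nonneg _)
  have hset : ∀ f : ℝ → ℝ, ∫ t in Ioo 0 x, f t ∂(leb L) = ∫ t in (0 : ℝ)..x, f t := fun f => by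
    rw [Measure.restrict_restrict measurableSet_Ioo,
      inter_eq_left.2 (Ioo_subset_Ioo_right hx.2), integral_of_le hx.1,
      integral_Ioc_eq_integral_Ioo]
  simp only [hset] at hlim
  refine tendsto_nhds_unique (hu x hx) (hlim.congr fun n => (hv (k n) x hx).symm)

end SingularODE

theorem mainTheorem5 (L : ℝ) (hL : 0 < L)
    (a : ℝ → ℝ) (ha : MemLp a ∞ (SingularODE.leb L))
    (α β : ℝ) (hα : 0 < α) (hαβ : α < β)
    (hab : ∀ᵐ x ∂(SingularODE.leb L), α ≤ a x ∧ a x ≤ β)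
    (h : ℝ → ℝ) (hh : MemLp h 2 (SingularODE.leb L))
    (φ : ℝ → EReal) (hφ : SingularODE.Admissible φ) :
    ∃ v : ℝ → ℝ, SingularODE.IsSolution L a h φ v := by
  -- Truncating a measurable representative makes the bounds hold at every real point without
  -- changing `a` a.e. on `(0, L)`; likewise `h` is extended by zero below.
  set a' : ℝ → ℝ := fun t => max α (min β (ha.1.mk a t)) with ha'
  have ha'm : AEStronglyMeasurable a' volume :=
    (measurable_const.max (measurable_const.min
      ha.1.stronglyMeasurable_mk.measurable)).aestronglyMeasurable
  have ha'b : ∀ t, α ≤ a' t ∧ a' t ≤ β := fun t =>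
    ⟨le_max_left _ _, max_le hαβ.le (min_le_left _ _)⟩
  have haa' : ∀ᵐ t ∂(SingularODE.leb L), a' t = a t := by
    filter_upwards [hab, ha.1.ae_eq_mk] with t ht hmk
    simp only [ha']
    rw [← hmk, min_eq_right ht.2, max_eq_right ht.1]
  have hh' : MemLp ((Ioo 0 L).indicator h) 2 volume :=
    (memLp_indicator_iff_restrict measurableSet_Ioo).2 hh
  have hhh' : ∀ᵐ t ∂(SingularODE.leb L), (Ioo 0 L).indicator h t = h t :=
    indicator_ae_eq_restrict measurableSet_Ioo
  obtain ⟨v, hvc, hvφ, hv⟩ :=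
    SingularODE.exists_integral_solution hL.le hα hαβ.le ha'm ha'b hh' hφ
  have ha'0 : ∀ t, 0 < a' t := fun t => hα.trans_le (ha'b t).1
  refine ⟨v, hvc.continuousOn, hvφ, ⟨_, SingularODE.hasH1Deriv_of_eq_integral hL.le hvc ?_ hv,
    fun η => ?_⟩, ?_⟩
  · refine (hvφ.2.add (hh'.restrict _)).of_le_mul (c := α⁻¹) ?_ (ae_of_all _ fun t => ?_)
    · exact ((hvφ.2.add (hh'.restrict _)).1.aemeasurable.div
        ha'm.restrict.aemeasurable).aestronglyMeasurable
    · rw [norm_div, div_eq_inv_mul, Real.norm_of_nonneg (ha'0 t).le]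
      exact mul_le_mul_of_nonneg_right (inv_anti₀ hα (ha'b t).1) (norm_nonneg _)
  · refine integral_congr_ae ?_
    filter_upwards [haa', hhh'] with t h1 h2
    rw [← h1, ← h2, mul_div_cancel₀ _ (ha'0 t).ne']
  · rw [hv 0 ⟨le_rfl, hL.le⟩, intervalIntegral.integral_same]
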